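/- Let $\mathcal{W}=W(2,2)$ be the complex Lie algebra with basis $\{L_n, W_n, z \mid n\in\mathbb{Z}\}$ and brackets $$[L_n,L_m]=(m-n)L_{m+n}+\tfrac{n^3-n}{12}\delta_{m+n,0}\,z,\qquad [L_n,W_m]=(m-n)W_{m+n}+\tfrac{n^3-n}{12}\delta_{m+n,0}\,z,$$ $$[W_n,W_m]=[z,L_m]=[z,W_m]=0 .$$ Let $\mathcal{W}_+$ be the subalgebra spanned by the $L_n, W_n$ with $n>0$, let $\mathcal{U}(\cdot)$ denote universal enveloping algebras, and let $\varphi:\mathcal{W}_+\to\mathbb{C}$ be a Lie algebra homomorphism which is non-singular, that is, $\varphi(L_i)\varphi(W_i)\neq 0$ for $i=1,2$; write $\varphi$ also for its extension to an algebra homomorphism $\mathcal{U}(\mathcal{W}_+)\to\mathbb{C}$. A vector $v$ of a $\mathcal{W}$-module $V$ is a Whittaker vector (of type $\varphi$) if $xv=\varphi(x)v$ for all $x\in\mathcal{W}_+$; if moreover $v$ generates $V$, then $v$ is a cyclic Whittaker vector and $V$ is a Whittaker module of type $\varphi$. Let $M_\varphi=\mathcal{U}(\mathcal{W})\otimes_{\mathcal{U}(\mathcal{W}_+)}\mathbb{C}_\varphi$,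 where $\mathbb{C}_\varphi$ is the one-dimensional $\mathcal{W}_+$-module given by $\varphi$, and, for $\xi\in\mathbb{C}$, let $L_{\varphi,\xi}=M_\varphi/(z-\xi)M_\varphi$. A positive partition is a non-empty non-decreasing sequence $\lambda=(\lambda_1\le\dots\le\lambda_r)$ of positive integers; put $L_\lambda=L_{\lambda_1}\cdots L_{\lambda_r}$ and $W_\lambda=W_{\lambda_1}\cdots W_{\lambda_r}$, and let $\mathcal{P}_+$ be the set of positive partitions. Proposition. Let $V$ be a nonzero Whittaker module of type $\varphi$ on which $z$ acts by the scalar $\xi\in\mathbb{C}$. Then $V\cong L_{\varphi,\xi}$ as $\mathcal{W}$-modules, and for every cyclic Whittaker vector $w$ of $V$ of type $\varphi$, $$\mathrm{Ann}_{\mathcal{U}(\mathcal{W})}(w)=\mathcal{U}(\mathcal{W})(z-\xi)+\sum_{\lambda,\mu\in\mathcal{P}_+}\mathcal{U}(\mathcal{W})\bigl(L_\lambda W_\mu-\varphi(L_\lambda W_\mu)\bigr).$$ -/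

import Mathlib

open scoped TensorProduct

attribute [local instance 100] LieRing.ofAssociativeRing

noncomputable section

/-- Labels of the standard basis `L n`, `W n` (`n ∈ ℤ`), `z` of the algebra `W(2,2)`. -/
inductive W22Gen : Type
  | L (n : ℤ) : W22Gen
  | W (n : ℤ) : W22Gen
  | z : W22Gen

/-- The underlying complex vector space of `W(2,2)`: finitely supported combinations of the
basis labels. -/
def W22 : Type := W22Gen →₀ ℂ

namespace W22

instance : AddCommGroup W22 := inferInstanceAs (AddCommGroup (W22Gen →₀ ℂ))
instance : Module ℂ W22 := inferInstanceAs (Module ℂ (W22Gen →₀ ℂ))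

/-- The standard basis. -/
def stdBasis : Module.Basis W22Gen ℂ W22 := Module.Basis.ofRepr (LinearEquiv.refl ℂ (W22Gen →₀ ℂ))

/-- The basis element `L_n`. -/
def L (n : ℤ) : W22 := stdBasis (W22Gen.L n)
/-- The basis element `W_n`. -/
def W (n : ℤ) : W22 := stdBasis (W22Gen.W n)
/-- The central basis element `z`. -/
def z : W22 := stdBasis W22Gen.z

/-- The central term `(n³ - n)/12 · δ_{m+n,0}`. -/
def cocycle (n m : ℤ) : ℂ := if m + n = 0 then ((n : ℂ) ^ 3 - n) / 12 else 0

/-- The bracket on basis elements: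
`[L_n, L_m] = (m-n) L_{m+n} + (n³-n)/12 δ_{m+n,0} z`,
`[L_n, W_m] = (m-n) W_{m+n} + (n³-n)/12 δ_{m+n,0} z`, `[W_n, L_m] = -[L_m, W_n]`,
and all other brackets vanish. -/
def bracketGen : W22Gen → W22Gen → W22
  | .L n, .L m => ((m : ℂ) - n) • L (m + n) + cocycle n m • z
  | .L n, .W m => ((m : ℂ) - n) • W (m + n) + cocycle n m • z
  | .W n, .L m => -(((n : ℂ) - m) • W (n + m) + cocycle m n • z)
  | _, _ => 0

/-- The bilinear extension of `bracketGen`. -/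
def bracketHom : W22 →ₗ[ℂ] W22 →ₗ[ℂ] W22 :=
  stdBasis.constr ℂ fun i => stdBasis.constr ℂ (bracketGen i)

lemma bracketHom_basis (i j : W22Gen) :
    bracketHom (stdBasis i) (stdBasis j) = bracketGen i j := by
  simp [bracketHom, Module.Basis.constr_basis]

lemma cocycle_skew (n m : ℤ) : cocycle n m = -cocycle m n := by
  unfold cocycle
  by_cases h : m + n = 0
  · obtain rfl : m = -n := by omega
    simp; ring
  · rw [if_neg h, if_neg (by omega)]; simp

lemma bracketGen_skew (i j : W22Gen) : bracketGen i j = -bracketGen j i := by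
  rcases i with n | n | _ <;> rcases j with m | m | _ <;> simp only [bracketGen, neg_neg, neg_zero]
  rw [cocycle_skew n m, add_comm m n]
  module

lemma bracketHom_skew (x y : W22) : bracketHom x y = -bracketHom y x := by
  have h : bracketHom = -bracketHom.flip := by
    refine stdBasis.ext fun i => stdBasis.ext fun j => ?_
    simp only [LinearMap.neg_apply, LinearMap.flip_apply, bracketHom_basis]
    exact bracketGen_skew i j
  calc bracketHom x y = (-bracketHom.flip) x y := by rw [← h]
    _ = _ := rfl

lemma bracketHom_LL (n m : ℤ) :
    bracketHom (L n) (L m) = ((m : ℂ) - n) • L (m + n) + cocycle n m • z := bracketHom_basis _ _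
lemma bracketHom_LW (n m : ℤ) :
    bracketHom (L n) (W m) = ((m : ℂ) - n) • W (m + n) + cocycle n m • z := bracketHom_basis _ _
lemma bracketHom_WL (n m : ℤ) :
    bracketHom (W n) (L m) = -(((n : ℂ) - m) • W (n + m) + cocycle m n • z) := bracketHom_basis _ _
lemma bracketHom_WW (n m : ℤ) : bracketHom (W n) (W m) = 0 := bracketHom_basis _ _
lemma bracketHom_z_left (x : W22) : bracketHom z x = 0 := by
  have : bracketHom z = 0 := stdBasis.ext fun j => by
    rw [z, bracketHom_basis]; cases j <;> rfl
  rw [this]; rfl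
lemma bracketHom_z_right (x : W22) : bracketHom x z = 0 := by
  rw [bracketHom_skew, bracketHom_z_left, neg_zero]

lemma cocycle_jacobi (a b c : ℤ) :
    ((c : ℂ) - b) * cocycle a (c + b) =
      ((b : ℂ) - a) * cocycle (b + a) c + ((c : ℂ) - a) * cocycle b (c + a) := by
  unfold cocycle
  by_cases h : a + b + c = 0
  · obtain rfl : c = -a - b := by omega
    rw [if_pos (by omega), if_pos (by omega), if_pos (by omega)]
    push_cast; ring
  · rw [if_neg (by omega), if_neg (by omega), if_neg (by omega)]; simp

/-- The Jacobi identity in Leibniz form, on basis elements. -/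
lemma bracketHom_leibniz_basis (i j k : W22Gen) :
    bracketHom (stdBasis i) (bracketHom (stdBasis j) (stdBasis k)) =
      bracketHom (bracketHom (stdBasis i) (stdBasis j)) (stdBasis k) +
        bracketHom (stdBasis j) (bracketHom (stdBasis i) (stdBasis k)) := by
  have hL (n) : stdBasis (W22Gen.L n) = L n := rfl
  have hW (n) : stdBasis (W22Gen.W n) = W n := rfl
  have hz : stdBasis W22Gen.z = z := rfl
  rcases i with a | a | _ <;> rcases j with b | b | _ <;> rcases k with c | c | _ <;>
    simp only [hL, hW, hz, bracketHom_LL, bracketHom_LW, bracketHom_WL, bracketHom_WW,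
      bracketHom_z_left, bracketHom_z_right, map_add, map_smul, map_neg, LinearMap.add_apply,
      LinearMap.smul_apply, LinearMap.neg_apply, smul_zero, add_zero, neg_zero,
      map_zero, LinearMap.zero_apply]
  all_goals
    have e1 : c + b + a = a + b + c := by ring
    have e2 : c + (b + a) = a + b + c := by ring
    have e3 : c + a + b = a + b + c := by ring
    have e4 : b + c + a = a + b + c := by ring
    have e5 : b + a + c = a + b + c := by ring
    have e6 : b + (c + a) = a + b + c := by ring
    have e7 : a + (c + b) = a + b + c := by ring
    have e8 : a + c + b = a + b + c := by ring
    have h := cocycle_jacobi a b c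
    simp only [e1, e2, e3, e4, e5, e6, e7, e8, smul_add, smul_smul, smul_neg]
    push_cast
  · linear_combination (norm := module) h • z
  · linear_combination (norm := module) h • z
  · rw [cocycle_skew c (b + a), cocycle_skew (c + a) b, add_comm b c]
    linear_combination (norm := module) h • z
  · rw [cocycle_skew (c + b) a, cocycle_skew c (a + b), add_comm a b, add_comm a c]
    linear_combination (norm := module) h • z

lemma bracketHom_leibniz (x y t : W22) :
    bracketHom x (bracketHom y t) =
      bracketHom (bracketHom x y) t + bracketHom y (bracketHom x t) := by
  induction stdBasis.mem_span x using Submodule.span_induction with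
  | zero => simp
  | add u v _ _ hu hv => simp only [map_add, LinearMap.add_apply, hu, hv]; abel
  | smul c u _ hu => simp only [map_smul, LinearMap.smul_apply, hu, smul_add]
  | mem u hu =>
    obtain ⟨i, rfl⟩ := hu
    induction stdBasis.mem_span y using Submodule.span_induction with
    | zero => simp
    | add u v _ _ hu hv => simp only [map_add, LinearMap.add_apply, hu, hv]; abel
    | smul c u _ hu => simp only [map_smul, LinearMap.smul_apply, hu, smul_add]
    | mem u hu =>
      obtain ⟨j, rfl⟩ := hu
      induction stdBasis.mem_span t using Submodule.span_induction with
      | zero => simp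
      | add u v _ _ hu hv => simp only [map_add, hu, hv]; abel
      | smul c u _ hu => simp only [map_smul, hu, smul_add]
      | mem u hu =>
        obtain ⟨k, rfl⟩ := hu
        exact bracketHom_leibniz_basis i j k

instance : LieRing W22 where
  bracket x y := bracketHom x y
  add_lie x y t := by simp
  lie_add x y t := by simp
  lie_self x := by
    have h : bracketHom x x + bracketHom x x = 0 := by
      nth_rewrite 1 [bracketHom_skew x x]; exact neg_add_cancel _
    rw [← two_smul ℂ] at h
    exact (smul_eq_zero.mp h).resolve_left two_ne_zero
  leibniz_lie x y t := bracketHom_leibniz x y t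

instance : LieAlgebra ℂ W22 where
  lie_smul c x y := (bracketHom x).map_smul c y

lemma lie_def (x y : W22) : ⁅x, y⁆ = bracketHom x y := rfl

/-- The subalgebra `W(2,2)₊`, spanned by the `L_n` and `W_n` with `n > 0`. -/
def plus : LieSubalgebra ℂ W22 where
  toSubmodule := Submodule.span ℂ {x | ∃ n : ℤ, 0 < n ∧ (x = L n ∨ x = W n)}
  lie_mem' {x y} hx hy := by
    have hL (n : ℤ) (hn : 0 < n) :
        L n ∈ Submodule.span ℂ {x | ∃ n : ℤ, 0 < n ∧ (x = L n ∨ x = W n)} :=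
      Submodule.subset_span ⟨n, hn, Or.inl rfl⟩
    have hW (n : ℤ) (hn : 0 < n) :
        W n ∈ Submodule.span ℂ {x | ∃ n : ℤ, 0 < n ∧ (x = L n ∨ x = W n)} :=
      Submodule.subset_span ⟨n, hn, Or.inr rfl⟩
    change bracketHom x y ∈ Submodule.span ℂ {x | ∃ n : ℤ, 0 < n ∧ (x = L n ∨ x = W n)}
    induction hx, hy using Submodule.span_induction₂ with
    | zero_left y _ => simp
    | zero_right x _ => simp
    | add_left x y t _ _ _ h₁ h₂ =>
      rw [map_add, LinearMap.add_apply]; exact add_mem h₁ h₂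
    | add_right x y t _ _ _ h₁ h₂ => rw [map_add]; exact add_mem h₁ h₂
    | smul_left c x y _ _ h =>
      rw [map_smul, LinearMap.smul_apply]; exact Submodule.smul_mem _ _ h
    | smul_right c x y _ _ h => rw [map_smul]; exact Submodule.smul_mem _ _ h
    | mem_mem x y hx hy =>
      obtain ⟨n, hn, rfl | rfl⟩ := hx <;> obtain ⟨m, hm, rfl | rfl⟩ := hy
      · rw [bracketHom_LL, cocycle, if_neg (by omega), zero_smul, add_zero]
        exact Submodule.smul_mem _ _ (hL _ (by omega))
      · rw [bracketHom_LW, cocycle, if_neg (by omega), zero_smul, add_zero]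
        exact Submodule.smul_mem _ _ (hW _ (by omega))
      · rw [bracketHom_WL, cocycle, if_neg (by omega), zero_smul, add_zero]
        exact neg_mem (Submodule.smul_mem _ _ (hW _ (by omega)))
      · rw [bracketHom_WW]; exact zero_mem _

/-- `L_n` (`n > 0`) as an element of `W(2,2)₊`. -/
def plusL (n : ℕ+) : plus := ⟨L n, Submodule.subset_span ⟨n, by exact_mod_cast n.pos, Or.inl rfl⟩⟩
/-- `W_n` (`n > 0`) as an element of `W(2,2)₊`. -/
def plusW (n : ℕ+) : plus := ⟨W n, Submodule.subset_span ⟨n, by exact_mod_cast n.pos, Or.inr rfl⟩⟩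

/-- The universal enveloping algebra of `W(2,2)`. -/
abbrev U : Type := UniversalEnvelopingAlgebra ℂ W22

/-- The universal enveloping algebra of `W(2,2)₊`. -/
abbrev UPlus : Type := UniversalEnvelopingAlgebra ℂ plus

/-- The map of enveloping algebras induced by the inclusion of `W(2,2)₊`. -/
def incl : UPlus →ₐ[ℂ] U :=
  UniversalEnvelopingAlgebra.lift ℂ ((UniversalEnvelopingAlgebra.ι ℂ).comp plus.incl)

/-- The element `z` of `U`. -/
def zU : U := UniversalEnvelopingAlgebra.ι ℂ z

/-- The extension of a Lie algebra homomorphism `φ : W(2,2)₊ → ℂ` to `U(W(2,2)₊)`. -/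
def char (φ : plus →ₗ⁅ℂ⁆ ℂ) : UPlus →ₐ[ℂ] ℂ := UniversalEnvelopingAlgebra.lift ℂ φ

/-- `φ` is non-singular if `φ(L_i) φ(W_i) ≠ 0` for `i = 1, 2`. -/
def NonSingular (φ : plus →ₗ⁅ℂ⁆ ℂ) : Prop :=
  φ (plusL 1) * φ (plusW 1) ≠ 0 ∧ φ (plusL 2) * φ (plusW 2) ≠ 0

/-- A positive partition: a non-empty non-decreasing sequence of positive integers. -/
structure PosPartition : Type where
  parts : List ℕ+
  ne_nil : parts ≠ []
  sorted : parts.Pairwise (· ≤ ·)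

/-- `L_λ = L_{λ₁} ⋯ L_{λᵣ}` for a positive partition `λ`, in `U(W(2,2)₊)`. -/
def PosPartition.L (lam : PosPartition) : UPlus :=
  (lam.parts.map fun n => UniversalEnvelopingAlgebra.ι ℂ (plusL n)).prod

/-- `W_λ = W_{λ₁} ⋯ W_{λᵣ}` for a positive partition `λ`, in `U(W(2,2)₊)`. -/
def PosPartition.W (lam : PosPartition) : UPlus :=
  (lam.parts.map fun n => UniversalEnvelopingAlgebra.ι ℂ (plusW n)).prod

/-! ### Whittaker modules -/

section Modules

variable {V : Type*} [AddCommGroup V] [Module ℂ V] [LieRingModule W22 V] [LieModule ℂ W22 V]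

/-- `v` is a Whittaker vector of type `φ`. -/
def IsWhittakerVector (φ : plus →ₗ⁅ℂ⁆ ℂ) (v : V) : Prop :=
  ∀ x : plus, ⁅(x : W22), v⁆ = φ x • v

/-- `v` is a cyclic Whittaker vector of type `φ`: it is a Whittaker vector and generates `V`. -/
def IsCyclicWhittakerVector (φ : plus →ₗ⁅ℂ⁆ ℂ) (v : V) : Prop :=
  IsWhittakerVector φ v ∧ LieSubmodule.lieSpan ℂ W22 {v} = ⊤

variable (V) in
/-- `V` is a Whittaker module of type `φ` (which must be non-singular). -/
def IsWhittakerModule (φ : plus →ₗ⁅ℂ⁆ ℂ) : Prop :=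
  NonSingular φ ∧ ∃ v : V, IsCyclicWhittakerVector φ v

/-- The annihilator in `U` of a vector of a `W(2,2)`-module, a left ideal. -/
def ann (v : V) : Ideal U where
  carrier := {u | UniversalEnvelopingAlgebra.lift ℂ (LieModule.toEnd ℂ W22 V) u v = 0}
  add_mem' {a b} ha hb := by
    simp only [Set.mem_ofPred_eq] at ha hb ⊢; rw [map_add, LinearMap.add_apply, ha, hb, add_zero]
  zero_mem' := by simp
  smul_mem' c a ha := by
    simp only [Set.mem_ofPred_eq] at ha ⊢
    rw [smul_eq_mul, map_mul, Module.End.mul_apply, ha, map_zero]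

end Modules

/-! ### The modules `M_φ` and `L_{φ,ξ}` -/

/-- The one-dimensional `U(W(2,2)₊)`-module `ℂ_φ`. -/
def CPhi (_φ : plus →ₗ⁅ℂ⁆ ℂ) : Type := ℂ

instance (φ : plus →ₗ⁅ℂ⁆ ℂ) : AddCommGroup (CPhi φ) := inferInstanceAs (AddCommGroup ℂ)
instance (φ : plus →ₗ⁅ℂ⁆ ℂ) : Module ℂ (CPhi φ) := inferInstanceAs (Module ℂ ℂ)
instance (φ : plus →ₗ⁅ℂ⁆ ℂ) : Module UPlus (CPhi φ) := Module.compHom ℂ (char φ).toRingHom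

/-- The relations `u x ⊗ a = u ⊗ x a` (`u ∈ U`, `x ∈ U(W(2,2)₊)`, `a ∈ ℂ_φ`) that define the
tensor product over the non-commutative ring `U(W(2,2)₊)` as a quotient of the one over `ℂ`. -/
def tensorRel (φ : plus →ₗ⁅ℂ⁆ ℂ) : Submodule U (U ⊗[ℂ] CPhi φ) :=
  Submodule.span U
    {t | ∃ (u : U) (x : UPlus) (a : CPhi φ), t = (u * incl x) ⊗ₜ[ℂ] a - u ⊗ₜ[ℂ] (x • a)}

/-- The universal Whittaker module `M_φ = U ⊗_{U(W(2,2)₊)} ℂ_φ`. -/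
abbrev M (φ : plus →ₗ⁅ℂ⁆ ℂ) : Type := (U ⊗[ℂ] CPhi φ) ⧸ tensorRel φ

/-- The submodule `(z - ξ) M_φ`. -/
def zSub (φ : plus →ₗ⁅ℂ⁆ ℂ) (ξ : ℂ) : Submodule U (M φ) :=
  Submodule.span U (Set.range fun m : M φ => (zU - algebraMap ℂ U ξ) • m)

/-- The module `L_{φ,ξ} = M_φ / (z - ξ) M_φ`. -/
def LMod (φ : plus →ₗ⁅ℂ⁆ ℂ) (ξ : ℂ) : Type := M φ ⧸ zSub φ ξ

section

variable (φ : plus →ₗ⁅ℂ⁆ ℂ) (ξ : ℂ)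

instance : AddCommGroup (LMod φ ξ) := inferInstanceAs (AddCommGroup (M φ ⧸ zSub φ ξ))
instance : Module U (LMod φ ξ) := inferInstanceAs (Module U (M φ ⧸ zSub φ ξ))
instance : Module ℂ (LMod φ ξ) := inferInstanceAs (Module ℂ (M φ ⧸ zSub φ ξ))
instance : IsScalarTower ℂ U (LMod φ ξ) := inferInstanceAs (IsScalarTower ℂ U (M φ ⧸ zSub φ ξ))

/-- `W(2,2)` acts on `L_{φ,ξ}` through `U`. -/
instance : LieRingModule W22 (LMod φ ξ) where
  bracket x m := UniversalEnvelopingAlgebra.ι ℂ x • m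
  add_lie x y m := by simp only [map_add, add_smul]
  lie_add x m n := by simp only [smul_add]
  leibniz_lie x y m := by
    change UniversalEnvelopingAlgebra.ι ℂ x • UniversalEnvelopingAlgebra.ι ℂ y • m =
      UniversalEnvelopingAlgebra.ι ℂ ⁅x, y⁆ • m +
        UniversalEnvelopingAlgebra.ι ℂ y • UniversalEnvelopingAlgebra.ι ℂ x • m
    rw [LieHom.map_lie, LieRing.of_associative_ring_bracket, sub_smul, mul_smul, mul_smul]
    abel

instance : LieModule ℂ W22 (LMod φ ξ) where
  smul_lie c x m := by
    change UniversalEnvelopingAlgebra.ι ℂ (c • x) • m = c • UniversalEnvelopingAlgebra.ι ℂ x • m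
    rw [map_smul, smul_assoc]
  lie_smul c x m := by
    change UniversalEnvelopingAlgebra.ι ℂ x • c • m = c • UniversalEnvelopingAlgebra.ι ℂ x • m
    rw [← algebraMap_smul U c m, ← algebraMap_smul U c (UniversalEnvelopingAlgebra.ι ℂ x • m),
      ← mul_smul, ← mul_smul, Algebra.commutes]

end

/-- The left ideal `U (z - ξ) + ∑_{λ,μ} U (L_λ W_μ - φ(L_λ W_μ))`, the sum over all pairs of
positive partitions. -/
def annIdeal (φ : plus →ₗ⁅ℂ⁆ ℂ) (ξ : ℂ) : Ideal U :=
  Ideal.span {zU - algebraMap ℂ U ξ} ⊔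
    ⨆ (lam : PosPartition) (mu : PosPartition),
      Ideal.span {incl (lam.L * mu.W) - algebraMap ℂ U (char φ (lam.L * mu.W))}

end W22

end

set_option linter.unusedSectionVars false

/-! Let S be the polynomial ring in the commuting operators W_0, W_{-1}, W_{-2}, …. When z acts by a
scalar and w is a Whittaker vector, `symbolMap` sends polynomials over S to S-combinations of
ordered words L_{-l₁} ⋯ L_{-lᵣ} w. It is onto if w generates (`symbolMap_surjective`), and injective
if w ≠ 0 and φ(W_2) ≠ 0 (`symbolMap_injective`).

Injectivity rests on a filtration by word length. Since φ kills brackets, φ(W_n) = 0 for n ≥ 3. So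
on words in L_0, …, L_{-J} only the bracket [L_{-J}, W_{J+2}] = (2J+2) W_2 matters to leading order,
and W_{J+2} - φ(W_{J+2}) acts on top symbols as a nonzero multiple of ∂/∂X_J. Differentiating in the
largest variable reduces a relation to one in S alone, where L_{J+2} acts in the same way.

The universal property gives a surjection from L_{φ,ξ} to V that carries one symbol map to the
other. The symbol map of V is injective and that of L_{φ,ξ} is onto, so the surjection is injective.
No Poincaré–Birkhoff–Witt theorem enters: the existence of V ≠ 0 shows that L_{φ,ξ} is nonzero.

For the annihilator, this injectivity reduces the claim to the generator of L_{φ,ξ}. The class of 1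
in the quotient of U by `annIdeal` is again a Whittaker vector (`incl_smul_eq_of_partitions`), so
L_{φ,ξ} maps to that quotient, and whatever kills the generator lies in the ideal. -/

noncomputable section

/-! ### Partial derivatives in the largest variable. -/

namespace MvPolynomial

variable {σ R : Type*} [CommRing R]

lemma pderiv_ne_zero_of_mem_vars [IsDomain R] [CharZero R] {i : σ} {f : MvPolynomial σ R}
    (h : i ∈ f.vars) : pderiv i f ≠ 0 := by
  obtain ⟨s, hs, hi⟩ := (mem_vars_iff_mem_support i).1 h
  intro h0
  have h1 : Finsupp.single i 1 ≤ s := by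
    rw [Finsupp.single_le_iff]
    exact Nat.one_le_iff_ne_zero.2 (Finsupp.mem_support_iff.1 hi)
  have h2 := coeff_pderiv (i := i) f (s - Finsupp.single i 1)
  rw [h0, coeff_zero, tsub_add_cancel_of_le h1] at h2
  rcases mul_eq_zero.1 h2.symm with h3 | h3
  · exact mem_support_iff.1 hs h3
  · exact Nat.cast_add_one_ne_zero _ h3

lemma totalDegree_pderiv_lt {i : σ} {f : MvPolynomial σ R}
    (h : 0 < f.totalDegree) : (pderiv i f).totalDegree < f.totalDegree := by
  refine (Finset.sup_lt_iff h).2 fun m hm => ?_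
  have h1 : m + Finsupp.single i 1 ∈ f.support := by
    rw [mem_support_iff]
    intro h0
    rw [mem_support_iff, coeff_pderiv, h0, zero_mul] at hm
    exact hm rfl
  have h2 := le_totalDegree h1
  rw [Finsupp.sum_add_index' (by simp) (by simp)] at h2
  simp at h2
  simp only [Finsupp.sum] at *
  omega

lemma exists_isGreatest_vars {f : MvPolynomial ℕ R} (h : f.totalDegree ≠ 0) :
    ∃ J ∈ f.vars, f ∈ supported R (Set.Iic J) := by
  have hne : f.vars.Nonempty := by
    rw [Finset.nonempty_iff_ne_empty]
    intro h0
    apply h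
    rw [totalDegree_eq_zero_iff]
    intro m hm x
    by_contra hx
    have : x ∈ f.vars := (mem_vars_iff_mem_support x).2 ⟨m, hm, Finsupp.mem_support_iff.2 hx⟩
    simp [h0] at this
  refine ⟨f.vars.max' hne, Finset.max'_mem _ _, mem_supported.2 fun i hi => ?_⟩
  exact Finset.le_max' _ _ hi

end MvPolynomial

namespace W22

open MvPolynomial

/-! ### The polynomial action of the W_{-j} and the words in the L_{-j}. -/

section Whittaker

variable {V : Type*} [AddCommGroup V] [Module ℂ V] [LieRingModule W22 V] [LieModule ℂ W22 V]

lemma lie_L_L (ξ : ℂ) (hz : ∀ v : V, ⁅z, v⁆ = ξ • v) (n m : ℤ) (v : V) :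
    ⁅L n, ⁅L m, v⁆⁆ =
      ⁅L m, ⁅L n, v⁆⁆ + (((m : ℂ) - n) • ⁅L (m + n), v⁆ + (cocycle n m * ξ) • v) := by
  rw [leibniz_lie, lie_def, bracketHom_LL, add_lie, smul_lie, smul_lie, hz, mul_smul, add_comm]

lemma lie_L_W (ξ : ℂ) (hz : ∀ v : V, ⁅z, v⁆ = ξ • v) (n m : ℤ) (v : V) :
    ⁅L n, ⁅W m, v⁆⁆ =
      ⁅W m, ⁅L n, v⁆⁆ + (((m : ℂ) - n) • ⁅W (m + n), v⁆ + (cocycle n m * ξ) • v) := by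
  rw [leibniz_lie, lie_def, bracketHom_LW, add_lie, smul_lie, smul_lie, hz, mul_smul, add_comm]

lemma lie_W_W (n m : ℤ) (v : V) : ⁅W n, ⁅W m, v⁆⁆ = ⁅W m, ⁅W n, v⁆⁆ := by
  rw [leibniz_lie, lie_def, bracketHom_WW, zero_lie, zero_add]

open scoped IsMulCommutative in
variable (V) in
lemma exists_algHom_toEnd_W : ∃ ρ : MvPolynomial ℕ ℂ →ₐ[ℂ] Module.End ℂ V,
    ∀ j : ℕ, ρ (X j) = LieModule.toEnd ℂ W22 V (W (-j)) := by
  let s : Set (Module.End ℂ V) := Set.range fun j : ℕ => LieModule.toEnd ℂ W22 V (W (-j))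
  have hs : ∀ a ∈ s, ∀ b ∈ s, a * b = b * a := by
    rintro _ ⟨i, rfl⟩ _ ⟨j, rfl⟩
    ext v
    exact lie_W_W _ _ v
  -- `aeval` needs a commutative target, so it lands in the subalgebra generated by the commuting
  -- operators.
  have := Algebra.isMulCommutative_adjoin ℂ hs
  let ρ : MvPolynomial ℕ ℂ →ₐ[ℂ] Algebra.adjoin ℂ s :=
    aeval fun j => ⟨LieModule.toEnd ℂ W22 V (W (-j)), Algebra.subset_adjoin ⟨j, rfl⟩⟩
  refine ⟨(Algebra.adjoin ℂ s).val.comp ρ, fun j => ?_⟩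
  simp [ρ]

/-- `w` is a nonzero vector on which `L_n`, `W_n` (`n > 0`) act by the scalars `α n`, `β n`, in a
module on which `z` acts by `ξ`, and the polynomial ring acts through the commuting operators
`W_{-j}` (`j ≥ 0`). -/
structure WhittakerData [Module (MvPolynomial ℕ ℂ) V] (ξ : ℂ) (α β : ℤ → ℂ) (w : V) : Prop where
  X_smul : ∀ (j : ℕ) (v : V), (X j : MvPolynomial ℕ ℂ) • v = ⁅W (-j), v⁆
  z_lie : ∀ v : V, ⁅z, v⁆ = ξ • v
  L_lie : ∀ n : ℤ, 0 < n → ⁅L n, w⁆ = α n • w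
  W_lie : ∀ n : ℤ, 0 < n → ⁅W n, w⁆ = β n • w
  two_ne_zero : β 2 ≠ 0
  eq_zero : ∀ n : ℤ, 3 ≤ n → β n = 0

/-- The vector `L_{-l₁} ⋯ L_{-lᵣ} w`. -/
def lieList (w : V) (l : List ℕ) : V := l.foldr (fun j v => ⁅L (-(j : ℤ)), v⁆) w

@[simp] lemma lieList_nil (w : V) : lieList w [] = w := rfl
@[simp] lemma lieList_cons (w : V) (j : ℕ) (l : List ℕ) :
    lieList w (j :: l) = ⁅L (-(j : ℤ)), lieList w l⁆ := rfl

variable [Module (MvPolynomial ℕ ℂ) V]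

/-- The span of the vectors `L_{-l₁} ⋯ L_{-lᵣ} w` with `r < d` over the polynomial ring. -/
def filt (w : V) (d : ℕ) : Submodule (MvPolynomial ℕ ℂ) V :=
  Submodule.span _ {v | ∃ l : List ℕ, l.length < d ∧ v = lieList w l}

lemma lieList_mem_filt (w : V) {l : List ℕ} {d : ℕ} (h : l.length < d) : lieList w l ∈ filt w d :=
  Submodule.subset_span ⟨l, h, rfl⟩

lemma filt_mono (w : V) {d e : ℕ} (h : d ≤ e) : filt w d ≤ filt w e :=
  Submodule.span_mono fun _ ⟨l, hl, hv⟩ => ⟨l, hl.trans_le h, hv⟩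

lemma filt_zero (w : V) : filt w 0 = ⊥ := by
  simp [filt]

variable (w : V) in
/-- The linear map that sends a monomial `∏ X_j ^ s_j` to the corresponding ordered product of
`L_{-j}` applied to `w`. -/
def symbolMap : MvPolynomial ℕ (MvPolynomial ℕ ℂ) →ₗ[MvPolynomial ℕ ℂ] V :=
  (basisMonomials ℕ (MvPolynomial ℕ ℂ)).constr (MvPolynomial ℕ ℂ)
    fun s => lieList w (s.toMultiset.sort (· ≤ ·))

lemma symbolMap_monomial (w : V) (s : ℕ →₀ ℕ) (c : MvPolynomial ℕ ℂ) :
    symbolMap w (monomial s c) = c • lieList w (s.toMultiset.sort (· ≤ ·)) := by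
  have : (monomial s c : MvPolynomial ℕ (MvPolynomial ℕ ℂ)) = c • monomial s 1 := by
    rw [smul_monomial, smul_eq_mul, mul_one]
  rw [this, map_smul]
  congr 1
  have := (basisMonomials ℕ (MvPolynomial ℕ ℂ)).constr_basis (MvPolynomial ℕ ℂ)
    (fun s => lieList w (s.toMultiset.sort (· ≤ ·))) s
  rwa [coe_basisMonomials] at this

variable [IsScalarTower ℂ (MvPolynomial ℕ ℂ) V]
variable {ξ : ℂ} {α β : ℤ → ℂ} {w : V}

namespace WhittakerData

variable (D : WhittakerData ξ α β w)
include D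

lemma lie_W_smul (m : ℤ) (Q : MvPolynomial ℕ ℂ) (v : V) : ⁅W m, Q • v⁆ = Q • ⁅W m, v⁆ := by
  induction Q using MvPolynomial.induction_on generalizing v with
  | C a =>
    rw [← algebraMap_eq, algebraMap_smul, algebraMap_smul, lie_smul]
  | add p q hp hq => rw [add_smul, lie_add, hp, hq, add_smul]
  | mul_X p j hp => rw [mul_smul, hp, D.X_smul, lie_W_W, mul_smul, D.X_smul]

lemma W_nonpos (m : ℤ) (hm : m ≤ 0) (v : V) :
    ⁅W m, v⁆ = (X m.natAbs : MvPolynomial ℕ ℂ) • v := by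
  rw [D.X_smul]; congr 2; omega

/-- Moving L_k past a factor W_{-j} of Q costs only a multiple of W_{k-j} and a scalar. For k ≤ 0
the former is again in S, so any S-submodule will do. -/
lemma lie_L_smul_sub_mem (k : ℤ) (Q : MvPolynomial ℕ ℂ) (N : Submodule (MvPolynomial ℕ ℂ) V)
    (hN : ∀ j : ℕ, ∀ u ∈ N, ⁅W (k - j), u⁆ ∈ N) (v : V) (hv : v ∈ N) :
    ⁅L k, Q • v⁆ - Q • ⁅L k, v⁆ ∈ N := by
  induction Q using MvPolynomial.induction_on generalizing v with
  | C a =>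
    rw [← algebraMap_eq, algebraMap_smul, algebraMap_smul, lie_smul, sub_self]
    exact zero_mem _
  | add p q hp hq =>
    rw [add_smul, lie_add, add_smul, add_sub_add_comm]
    exact add_mem (hp v hv) (hq v hv)
  | mul_X p j hp =>
    have h1 := hp (X j • v) (N.smul_mem _ hv)
    have h2 : p • (⁅L k, (X j : MvPolynomial ℕ ℂ) • v⁆ - (X j : MvPolynomial ℕ ℂ) • ⁅L k, v⁆) ∈ N := by
      refine N.smul_mem _ ?_
      rw [D.X_smul, D.X_smul, lie_L_W ξ D.z_lie, add_sub_cancel_left]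
      refine add_mem (N.smul_of_tower_mem _ ?_) (N.smul_of_tower_mem _ hv)
      have := hN j v hv
      rwa [show (k - j : ℤ) = -j + k by ring] at this
    have h3 := add_mem h1 h2
    rw [smul_sub, sub_add_sub_cancel, ← mul_smul, ← mul_smul] at h3
    exact h3

lemma lie_L_smul_sub_mem_of_nonpos (k : ℤ) (hk : k ≤ 0) (Q : MvPolynomial ℕ ℂ)
    (N : Submodule (MvPolynomial ℕ ℂ) V) (v : V) (hv : v ∈ N) :
    ⁅L k, Q • v⁆ - Q • ⁅L k, v⁆ ∈ N :=
  D.lie_L_smul_sub_mem k Q N (fun j u hu => by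
    rw [D.W_nonpos _ (by omega)]; exact N.smul_mem _ hu) v hv

lemma lie_L_mem_filt (j : ℕ) {d : ℕ} {v : V} (hv : v ∈ filt w d) :
    ⁅L (-(j : ℤ)), v⁆ ∈ filt w (d + 1) := by
  induction hv using Submodule.span_induction with
  | zero => simp
  | add x y _ _ hx hy => rw [lie_add]; exact add_mem hx hy
  | mem x hx =>
    obtain ⟨l, hl, rfl⟩ := hx
    rw [← lieList_cons]
    exact lieList_mem_filt w (by simpa using hl)
  | smul Q x hx ih =>
    have h1 := D.lie_L_smul_sub_mem_of_nonpos (-(j : ℤ)) (by omega) Q (filt w (d + 1)) x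
      (filt_mono w (Nat.le_succ d) hx)
    exact (Submodule.sub_mem_iff_left _ (Submodule.smul_mem _ Q ih)).1 h1

/-- A swap of neighbours replaces two letters by one letter or by a scalar, so the error is a
shorter word. -/
lemma lieList_perm {l l' : List ℕ} (h : l.Perm l') :
    ∀ d, l.length ≤ d → lieList w l - lieList w l' ∈ filt w d := by
  induction h with
  | nil => intro d _; simp
  | cons j _ ih =>
    intro d hd
    rw [List.length_cons] at hd
    obtain ⟨d, rfl⟩ : ∃ e, d = e + 1 := ⟨d - 1, by omega⟩
    rw [lieList_cons, lieList_cons, ← lie_sub]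
    exact D.lie_L_mem_filt j (ih d (by omega))
  | swap a b l =>
    intro d hd
    simp only [List.length_cons] at hd
    rw [lieList_cons, lieList_cons, lieList_cons, lieList_cons, lie_L_L ξ D.z_lie,
      add_sub_cancel_left]
    refine add_mem (Submodule.smul_of_tower_mem _ _ ?_) (Submodule.smul_of_tower_mem _ _ ?_)
    · rw [show (-(a : ℤ) + -(b : ℤ)) = -((a + b : ℕ) : ℤ) by push_cast; ring, ← lieList_cons]
      exact lieList_mem_filt w (by simp; omega)
    · exact lieList_mem_filt w (by omega)
  | trans h1 _ ih1 ih2 =>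
    intro d hd
    rw [← sub_add_sub_cancel]
    exact add_mem (ih1 d hd) (ih2 d (h1.length_eq ▸ hd))

/-! ### Leading terms of the positive W_m on the filtration. -/

lemma lie_W_lieList (l : List ℕ) : ∀ m : ℤ, 0 < m →
    ⁅W m, lieList w l⁆ - β m • lieList w l ∈ filt w l.length := by
  induction l with
  | nil => intro m hm; simp [D.W_lie m hm]
  | cons j l ih =>
    intro m hm
    have h1 := D.lie_L_mem_filt j (ih m hm)
    have h2 := lie_L_W ξ D.z_lie (-(j : ℤ)) m (lieList w l)
    rw [lie_sub, lie_smul, h2, add_sub_right_comm] at h1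
    refine (Submodule.add_mem_iff_left _ ?_).1 h1
    have hl : lieList w l ∈ filt w (l.length + 1) := lieList_mem_filt w (Nat.lt_succ_self _)
    refine add_mem (Submodule.smul_of_tower_mem _ _ ?_) (Submodule.smul_of_tower_mem _ _ hl)
    rcases le_or_gt (m + -(j : ℤ)) 0 with h | h
    · rw [D.W_nonpos _ h]; exact Submodule.smul_mem _ _ hl
    · exact (Submodule.sub_mem_iff_left _ (Submodule.smul_of_tower_mem _ _ hl)).1
        (filt_mono w (Nat.le_succ _) (ih _ h))

lemma lie_W_sub_mem_filt (m : ℤ) (hm : 0 < m) {d : ℕ} {v : V} (hv : v ∈ filt w (d + 1)) :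
    ⁅W m, v⁆ - β m • v ∈ filt w d := by
  induction hv using Submodule.span_induction with
  | zero => simp
  | add x y _ _ hx hy => rw [lie_add, smul_add, add_sub_add_comm]; exact add_mem hx hy
  | mem x hx =>
    obtain ⟨l, hl, rfl⟩ := hx
    exact filt_mono w (by omega) (D.lie_W_lieList l m hm)
  | smul Q x hx ih =>
    rw [D.lie_W_smul, smul_comm, ← smul_sub]
    exact Submodule.smul_mem _ _ ih

lemma lie_W_mem_filt (m : ℤ) {d : ℕ} {v : V} (hv : v ∈ filt w d) : ⁅W m, v⁆ ∈ filt w d := by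
  rcases le_or_gt m 0 with h | h
  · rw [D.W_nonpos _ h]; exact Submodule.smul_mem _ _ hv
  · exact (Submodule.sub_mem_iff_left _ (Submodule.smul_of_tower_mem _ _ hv)).1
      (D.lie_W_sub_mem_filt m h (filt_mono w (Nat.le_succ _) hv))

/-- The second-order refinement of `lie_W_lieList`: the error is two letters shorter than the word,
so the term that deletes one letter J becomes visible. -/
lemma lie_W_lieList_sub_mem (J : ℕ) (l : List ℕ) (hl : ∀ j ∈ l, j ≤ J) : ∀ d, l.length ≤ d + 1 →
    ⁅W (J + 2), lieList w l⁆ - β (J + 2) • lieList w l -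
      ((l.count J : ℂ) * (-(2 * J + 2) * β 2)) • lieList w (l.erase J) ∈ filt w d := by
  induction l with
  | nil =>
    intro d _
    simp [D.W_lie (J + 2) (by omega)]
  | cons j l ih =>
    intro d hd
    rw [List.length_cons, Nat.add_le_add_iff_right] at hd
    have hj : j ≤ J := hl j (by simp)
    have hl' : ∀ i ∈ l, i ≤ J := fun i hi => hl i (by simp [hi])
    set v := lieList w l with hv
    have h1 : ⁅L (-(j : ℤ)), ⁅W (J + 2), v⁆ - β (J + 2) • v⁆ -
        ((l.count J : ℂ) * (-(2 * J + 2) * β 2)) • ⁅L (-(j : ℤ)), lieList w (l.erase J)⁆ ∈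
        filt w d := by
      -- For d = 0 the filtration step is zero, so an exact equality is needed; the tail is then
      -- empty.
      rcases d with _ | d
      · obtain rfl : l = [] := List.eq_nil_of_length_eq_zero (by omega)
        simp [hv, D.W_lie (J + 2) (by omega)]
      · have := D.lie_L_mem_filt j (ih hl' d hd)
        rwa [lie_sub, lie_smul] at this
    have h2 := lie_L_W ξ D.z_lie (-(j : ℤ)) (J + 2) v
    rw [cocycle, if_neg (by omega), zero_mul, zero_smul, add_zero] at h2
    have h3 := Submodule.smul_of_tower_mem (filt w d) ((J : ℂ) + 2 + j)
      (filt_mono w hd (D.lie_W_lieList l (J + 2 + -(j : ℤ)) (by omega)))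
    rw [← hv] at h3
    rw [lie_sub, lie_smul, h2] at h1
    push_cast at h1
    rw [lieList_cons, ← hv]
    -- The bracket gives W_{J+2-j}. For j < J its index is at least 3 and its leading scalar
    -- vanishes; for j = J it is W_2, which adds one deletion of J.
    rcases hj.lt_or_eq with hlt | rfl
    · rw [D.eq_zero _ (by omega)] at h3
      rw [List.count_cons_of_ne (by omega), List.erase_cons_tail (by simpa using by omega),
        lieList_cons]
      convert sub_mem h1 h3 using 1
      module
    · rw [List.count_cons_self, List.erase_cons_head, ← hv]
      have h4 : ((l.count j : ℂ) * (-(2 * j + 2) * β 2)) •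
          (⁅L (-(j : ℤ)), lieList w (l.erase j)⁆ - v) ∈ filt w d := by
        by_cases hm : j ∈ l
        · rw [← lieList_cons]
          have hp := (List.perm_cons_erase hm).symm
          exact Submodule.smul_of_tower_mem _ _ (D.lieList_perm hp d (hp.length_eq ▸ hd))
        · rw [List.count_eq_zero_of_not_mem hm]; simp
      rw [show ((j : ℤ) + 2 + -j) = 2 by ring] at h1 h3
      convert add_mem (sub_mem h1 h3) h4 using 1
      push_cast
      module

/-- Deleting J from a word, weighted by its multiplicity, is ∂/∂X_J on monomials; the coefficients
in S commute with W_{J+2}. -/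
lemma lie_W_symbolMap_sub_mem {J d : ℕ} {f : MvPolynomial ℕ (MvPolynomial ℕ ℂ)}
    (hf : f.IsHomogeneous (d + 1)) (hJ : f ∈ supported (MvPolynomial ℕ ℂ) (Set.Iic J)) :
    ⁅W (J + 2), symbolMap w f⁆ - β (J + 2) • symbolMap w f -
      (-(2 * J + 2) * β 2) • symbolMap w (pderiv J f) ∈ filt w d := by
  have key : ∀ s ∈ f.support,
      ⁅W (J + 2), symbolMap w (monomial s (coeff s f))⁆ -
        β (J + 2) • symbolMap w (monomial s (coeff s f)) -
        (-(2 * J + 2) * β 2) • symbolMap w (pderiv J (monomial s (coeff s f))) ∈ filt w d := by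
    intro s hs
    set l := s.toMultiset.sort (· ≤ ·) with hl
    have hls : (l : Multiset ℕ) = s.toMultiset := Multiset.sort_eq _ _
    have hlen : l.length = d + 1 := by
      rw [hl, Multiset.length_sort, Finsupp.card_toMultiset]
      have := hf (mem_support_iff.1 hs)
      rw [← this]
      simp [Finsupp.weight_apply, Finsupp.sum]
    have hlJ : ∀ j ∈ l, j ≤ J := by
      intro j hj
      rw [hl, Multiset.mem_sort, Finsupp.mem_toMultiset] at hj
      exact mem_supported.1 hJ ((mem_vars_iff_mem_support j).2 ⟨s, hs, hj⟩)
    have hcount : l.count J = s J := by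
      rw [← Multiset.coe_count, hls, Finsupp.count_toMultiset]
    have h1 := D.lie_W_lieList_sub_mem J l hlJ d hlen.le
    rw [hcount] at h1
    have h2 : (s J : ℂ) • (lieList w (l.erase J) -
        lieList w ((s - Finsupp.single J 1).toMultiset.sort (· ≤ ·))) ∈ filt w d := by
      by_cases hm : J ∈ l
      · refine Submodule.smul_of_tower_mem _ _ (D.lieList_perm ?_ d ?_)
        · rw [← Multiset.coe_eq_coe, ← Multiset.coe_erase, hls, Multiset.sort_eq]
          ext i
          rw [Finsupp.count_toMultiset, Finsupp.tsub_apply]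
          by_cases hi : i = J
          · subst hi; simp
          · rw [Multiset.count_erase_of_ne hi, Finsupp.count_toMultiset,
              Finsupp.single_eq_of_ne hi, tsub_zero]
        · rw [List.length_erase_of_mem hm]; omega
      · rw [← hcount, List.count_eq_zero_of_not_mem hm]; simp
    have h3 := add_mem h1 (Submodule.smul_of_tower_mem _ (-(2 * (J : ℂ) + 2) * β 2) h2)
    have h4 := Submodule.smul_mem _ (coeff s f) h3
    rw [pderiv_monomial, symbolMap_monomial, symbolMap_monomial, D.lie_W_smul]
    convert h4 using 1
    rw [mul_smul (coeff s f) ((s J : ℕ) : MvPolynomial ℕ ℂ), Nat.cast_smul_eq_nsmul, ← hl,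
      smul_comm (β _), smul_comm (_ * _) (coeff s f), ← smul_sub, ← smul_sub,
      ← Nat.cast_smul_eq_nsmul ℂ]
    congr 1
    module
  have h := sum_mem key
  rw [Finset.sum_sub_distrib, Finset.sum_sub_distrib, ← Finset.smul_sum, ← Finset.smul_sum,
    ← lie_sum, ← map_sum, ← map_sum, ← map_sum, support_sum_monomial_coeff] at h
  exact h

/-! ### Injectivity of the symbol map. -/

lemma lie_W_smul_self (n : ℤ) (Q : MvPolynomial ℕ ℂ) :
    ⁅W n, Q • w⁆ = ((if n ≤ 0 then X n.natAbs else C (β n)) * Q) • w := by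
  split_ifs with h
  · rw [D.W_nonpos n h, mul_smul]
  · rw [D.lie_W_smul, D.W_lie n (by omega), mul_comm, mul_smul, ← algebraMap_eq, algebraMap_smul]

/-- Bracketing with L_k is a derivation; its value on X_j is [L_k, W_{-j}], where W_{k-j} is a
variable of S if k ≤ j and acts on w by a scalar otherwise. -/
lemma lie_L_smul_self (k : ℤ) (hk : 0 < k) (Q : MvPolynomial ℕ ℂ) :
    ⁅L k, Q • w⁆ = (α k • Q + mkDerivation ℂ (fun j : ℕ => ((-j - k : ℂ)) •
      (if -(j : ℤ) + k ≤ 0 then X (-(j : ℤ) + k).natAbs else C (β (-(j : ℤ) + k))) +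
        C (cocycle k (-j) * ξ)) Q) • w := by
  set δ := mkDerivation ℂ (fun j : ℕ => ((-j - k : ℂ)) •
      (if -(j : ℤ) + k ≤ 0 then X (-(j : ℤ) + k).natAbs else C (β (-(j : ℤ) + k))) +
        C (cocycle k (-j) * ξ)) with hδ
  induction Q using MvPolynomial.induction_on with
  | C a =>
    rw [derivation_C, add_zero, ← algebraMap_eq, algebraMap_smul, lie_smul, D.L_lie k hk,
      smul_assoc, algebraMap_smul, smul_comm]
  | add p q hp hq =>
    rw [add_smul, lie_add, hp, hq, map_add, smul_add, ← add_smul, add_add_add_comm]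
  | mul_X p j hp =>
    have hX : δ (X j) = ((-j - k : ℂ)) •
      (if -(j : ℤ) + k ≤ 0 then X (-(j : ℤ) + k).natAbs else C (β (-(j : ℤ) + k))) +
        C (cocycle k (-j) * ξ) := by rw [hδ, mkDerivation_X]
    rw [mul_comm, mul_smul, D.X_smul, lie_L_W ξ D.z_lie, hp, D.lie_W_smul_self (_ + _), ← D.X_smul,
      Derivation.leibniz, hX, ← algebraMap_smul (MvPolynomial ℕ ℂ) (cocycle _ _ * _),
      ← algebraMap_smul (MvPolynomial ℕ ℂ) (_ - _ : ℂ)]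
    simp only [← mul_smul, ← add_smul, algebraMap_eq, smul_eq_mul, smul_eq_C_mul]
    congr 1
    push_cast
    ring

lemma eq_zero_of_smul_eq_zero (hw : w ≠ 0) (Q : MvPolynomial ℕ ℂ) (h : Q • w = 0) : Q = 0 := by
  induction hn : Q.totalDegree using Nat.strong_induction_on generalizing Q with
  | _ n ih =>
    subst hn
    by_cases h0 : Q.totalDegree = 0
    · rw [totalDegree_eq_zero_iff_eq_C] at h0
      rw [h0, ← algebraMap_eq, algebraMap_smul] at h
      rw [h0, (smul_eq_zero.1 h).resolve_right hw, map_zero]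
    · obtain ⟨J, hJ, hs⟩ := exists_isGreatest_vars h0
      have h1 := D.lie_L_smul_self (J + 2) (by omega) Q
      -- For j ≤ J the value on X_j is a multiple of β (J + 2 - j), which is zero unless j = J. So
      -- the derivation is a multiple of ∂/∂X_J on polynomials in X_0, …, X_J.
      have h2 := derivation_eqOn_supported (D₁ := mkDerivation ℂ (fun j : ℕ =>
        ((-j - ((J + 2 : ℤ) : ℂ) : ℂ)) •
          (if -(j : ℤ) + (J + 2 : ℤ) ≤ 0 then X (-(j : ℤ) + (J + 2 : ℤ)).natAbs
            else C (β (-(j : ℤ) + (J + 2 : ℤ)))) + C (cocycle (J + 2 : ℤ) (-j) * ξ)))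
        (D₂ := (-(2 * J + 2) * β 2) • pderiv J) (s := Set.Iic J) (by
          intro j hj
          rw [Set.mem_Iic] at hj
          simp only [Function.comp, mkDerivation_X, Derivation.smul_apply]
          rw [if_neg (by omega), cocycle, if_neg (by omega), zero_mul, map_zero, add_zero]
          rcases hj.lt_or_eq with hlt | rfl
          · rw [D.eq_zero _ (by omega), pderiv_X_of_ne (by omega), map_zero, smul_zero, smul_zero]
          · rw [pderiv_X_self, show (-(j : ℤ) + (j + 2)) = 2 by ring, smul_eq_C_mul, smul_eq_C_mul,
              mul_one, ← C_mul]
            congr 1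
            push_cast
            ring) hs
      rw [h2, add_smul, smul_assoc, h, smul_zero, zero_add, lie_zero, Derivation.smul_apply,
        smul_assoc] at h1
      have h3 := (smul_eq_zero.1 h1.symm).resolve_left
        (mul_ne_zero (neg_ne_zero.2 (by exact_mod_cast (by omega : 2 * J + 2 ≠ 0))) D.two_ne_zero)
      exact absurd (ih _ (totalDegree_pderiv_lt (Nat.pos_of_ne_zero h0)) _ h3 rfl)
        (pderiv_ne_zero_of_mem_vars hJ)

/-- If a symbol of degree d + 1 falls one step in the filtration, so does its derivative in the
largest variable; the latter vanishes by induction, although that variable occurs. -/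
lemma eq_zero_of_symbolMap_mem (hw : w ≠ 0) (d : ℕ) :
    ∀ f : MvPolynomial ℕ (MvPolynomial ℕ ℂ), f.IsHomogeneous d → symbolMap w f ∈ filt w d →
      f = 0 := by
  induction d with
  | zero =>
    intro f hf h
    have h0 := totalDegree_eq_zero_iff_eq_C.1 (Nat.le_zero.1 hf.totalDegree_le)
    rw [h0, C_apply, symbolMap_monomial, filt_zero, Submodule.mem_bot] at h
    rw [h0, D.eq_zero_of_smul_eq_zero hw (coeff 0 f) (by simpa using h), map_zero]
  | succ d ih =>
    intro f hf h
    by_contra hne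
    have hd : f.totalDegree ≠ 0 := by rw [hf.totalDegree hne]; omega
    obtain ⟨J, hJ, hs⟩ := exists_isGreatest_vars hd
    have h1 := D.lie_W_symbolMap_sub_mem hf hs
    have h2 := D.lie_W_sub_mem_filt (J + 2) (by omega) h
    have h3 := (Submodule.sub_mem_iff_right _ h2).1 h1
    have hκ : (-(2 * (J : ℂ) + 2) * β 2) ≠ 0 :=
      mul_ne_zero (neg_ne_zero.2 (by exact_mod_cast (by omega : 2 * J + 2 ≠ 0))) D.two_ne_zero
    have h4 := Submodule.smul_of_tower_mem (filt w d) (-(2 * (J : ℂ) + 2) * β 2)⁻¹ h3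
    rw [inv_smul_smul₀ hκ] at h4
    exact pderiv_ne_zero_of_mem_vars hJ (ih _ hf.pderiv h4)

omit D in
lemma symbolMap_mem_filt {f : MvPolynomial ℕ (MvPolynomial ℕ ℂ)} {d : ℕ}
    (hf : f.totalDegree < d) : symbolMap w f ∈ filt w d := by
  rw [f.as_sum, map_sum]
  refine sum_mem fun s hs => ?_
  rw [symbolMap_monomial]
  refine Submodule.smul_mem _ _ (lieList_mem_filt w ?_)
  rw [Multiset.length_sort, Finsupp.card_toMultiset]
  exact (le_totalDegree hs).trans_lt hf

/-- In a relation the top homogeneous component equals minus the lower ones, hence falls in the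
filtration. -/
lemma symbolMap_injective (hw : w ≠ 0) : Function.Injective (symbolMap w) := by
  rw [← LinearMap.ker_eq_bot, LinearMap.ker_eq_bot']
  intro f hf
  by_contra hne
  have h1 := f.sum_homogeneousComponent
  rw [Finset.sum_range_succ] at h1
  have h2 : symbolMap w (∑ i ∈ Finset.range f.totalDegree, homogeneousComponent i f) ∈
      filt w f.totalDegree := by
    rw [map_sum]
    refine sum_mem fun i hi => symbolMap_mem_filt ?_
    exact ((homogeneousComponent_isHomogeneous i f).totalDegree_le).trans_lt (Finset.mem_range.1 hi)
  rw [← h1, map_add] at hf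
  rw [eq_neg_of_add_eq_zero_left hf, Submodule.neg_mem_iff] at h2
  have h3 := D.eq_zero_of_symbolMap_mem hw _ _ (homogeneousComponent_isHomogeneous _ f) h2
  obtain ⟨s, hs, hsd⟩ := Finset.exists_mem_eq_sup f.support (support_nonempty.2 hne)
    fun s => s.sum fun _ e => e
  have h4 : coeff s (homogeneousComponent f.totalDegree f) = coeff s f := by
    rw [coeff_homogeneousComponent, if_pos]
    exact hsd.symm
  rw [h3, coeff_zero] at h4
  exact mem_support_iff.1 hs h4.symm

/-! ### Surjectivity of the symbol map. -/

lemma filt_le_range (d : ℕ) : filt w d ≤ LinearMap.range (symbolMap w) := by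
  induction d with
  | zero => rw [filt_zero]; exact bot_le
  | succ d ih =>
    refine Submodule.span_le.2 ?_
    rintro _ ⟨l, hl, rfl⟩
    have h1 : lieList w l - symbolMap w (monomial (Multiset.toFinsupp (l : Multiset ℕ)) 1) ∈
        filt w d := by
      rw [symbolMap_monomial, one_smul]
      refine D.lieList_perm ?_ d (by omega)
      rw [← Multiset.coe_eq_coe, Multiset.sort_eq, Multiset.toFinsupp_toMultiset]
    exact (Submodule.sub_mem_iff_left _ (LinearMap.mem_range_self _ _)).1 (ih h1)

lemma symbolMap_surjective (hw : LieSubmodule.lieSpan ℂ W22 {w} = ⊤) :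
    Function.Surjective (symbolMap w) := by
  let N : Submodule (MvPolynomial ℕ ℂ) V := Submodule.span _ (Set.range (lieList w))
  have hle (d : ℕ) : filt w d ≤ N := Submodule.span_mono fun _ ⟨l, _, h⟩ => ⟨l, h.symm⟩
  have hN : N ≤ LinearMap.range (symbolMap w) := by
    refine Submodule.span_le.2 ?_
    rintro _ ⟨l, rfl⟩
    exact D.filt_le_range (l.length + 1) (lieList_mem_filt w (Nat.lt_succ_self _))
  have hW (m : ℤ) : ∀ v ∈ N, ⁅W m, v⁆ ∈ N := by
    intro v hv
    induction hv using Submodule.span_induction with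
    | zero => simp
    | add x y _ _ hx hy => rw [lie_add]; exact add_mem hx hy
    | smul Q x _ ih => rw [D.lie_W_smul]; exact N.smul_mem _ ih
    | mem x hx =>
      obtain ⟨l, rfl⟩ := hx
      exact hle _ (D.lie_W_mem_filt m (lieList_mem_filt w (Nat.lt_succ_self _)))
  -- Moving L_k past L_{-j} produces L_{k-j}, so the induction on the word has to cover all k at
  -- once.
  have hLl (l : List ℕ) : ∀ k : ℤ, ⁅L k, lieList w l⁆ ∈ N := by
    have hnonpos (l : List ℕ) (k : ℤ) (hk : k ≤ 0) : ⁅L k, lieList w l⁆ ∈ N := by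
      obtain ⟨j, rfl⟩ : ∃ j : ℕ, k = -j := ⟨k.natAbs, by omega⟩
      exact Submodule.subset_span ⟨j :: l, rfl⟩
    induction l with
    | nil =>
      intro k
      rcases le_or_gt k 0 with hk | hk
      · exact hnonpos _ k hk
      · rw [lieList_nil, D.L_lie k hk]
        exact Submodule.smul_of_tower_mem _ _ (Submodule.subset_span ⟨[], rfl⟩)
    | cons j l ih =>
      intro k
      rw [lieList_cons, lie_L_L ξ D.z_lie]
      have hl : lieList w l ∈ N := Submodule.subset_span ⟨l, rfl⟩
      refine add_mem ?_ (add_mem (Submodule.smul_of_tower_mem _ _ (ih _))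
        (Submodule.smul_of_tower_mem _ _ hl))
      have h (v : V) (hv : v ∈ N) : ⁅L (-(j : ℤ)), v⁆ ∈ N := by
        induction hv using Submodule.span_induction with
        | zero => simp
        | add x y _ _ hx hy => rw [lie_add]; exact add_mem hx hy
        | smul Q x hx ih =>
          exact (Submodule.sub_mem_iff_left _ (N.smul_mem Q ih)).1
            (D.lie_L_smul_sub_mem _ Q N (fun i u hu => hW _ u hu) x hx)
        | mem x hx =>
          obtain ⟨l, rfl⟩ := hx
          exact hnonpos l _ (by omega)
      exact h _ (ih k)
  have hL (k : ℤ) : ∀ v ∈ N, ⁅L k, v⁆ ∈ N := by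
    intro v hv
    induction hv using Submodule.span_induction with
    | zero => simp
    | add x y _ _ hx hy => rw [lie_add]; exact add_mem hx hy
    | smul Q x hx ih =>
      exact (Submodule.sub_mem_iff_left _ (N.smul_mem Q ih)).1
        (D.lie_L_smul_sub_mem _ Q N (fun i u hu => hW _ u hu) x hx)
    | mem x hx =>
      obtain ⟨l, rfl⟩ := hx
      exact hLl l k
  let N' : LieSubmodule ℂ W22 V :=
    { N.restrictScalars ℂ with
      lie_mem := by
        intro x v hv
        induction stdBasis.mem_span x using Submodule.span_induction with
        | zero => rw [zero_lie]; exact N.zero_mem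
        | add x y _ _ hx hy => rw [add_lie]; exact N.add_mem hx hy
        | smul c x _ hx => rw [smul_lie]; exact N.smul_of_tower_mem c hx
        | mem x hx =>
          obtain ⟨n | n | _, rfl⟩ := hx
          · exact hL n v hv
          · exact hW n v hv
          · exact (D.z_lie v).symm ▸ N.smul_of_tower_mem ξ hv }
  have hN' : N' = ⊤ := by
    rw [eq_top_iff, ← hw, LieSubmodule.lieSpan_le, Set.singleton_subset_iff]
    exact Submodule.subset_span ⟨[], rfl⟩
  intro v
  have hv : v ∈ N' := hN' ▸ LieSubmodule.mem_top v
  exact hN hv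

end WhittakerData

end Whittaker

/-! ### Comparison of two modules through their symbol maps. -/

section Comparison

variable {V : Type*} [AddCommGroup V] [Module ℂ V] [LieRingModule W22 V] [LieModule ℂ W22 V]
variable {V' : Type*} [AddCommGroup V'] [Module ℂ V'] [LieRingModule W22 V'] [LieModule ℂ W22 V']

/-- A homomorphism from a cyclic Whittaker module to another module with the same central
character that does not kill the generator is injective. -/
lemma injective_of_isWhittakerVector {ξ : ℂ} {α β : ℤ → ℂ} (hβ : β 2 ≠ 0)
    (hβ' : ∀ n : ℤ, 3 ≤ n → β n = 0) (π : V' →ₗ⁅ℂ, W22⁆ V) (w : V')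
    (hz' : ∀ v : V', ⁅z, v⁆ = ξ • v) (hz : ∀ v : V, ⁅z, v⁆ = ξ • v)
    (hL : ∀ n : ℤ, 0 < n → ⁅L n, w⁆ = α n • w) (hW : ∀ n : ℤ, 0 < n → ⁅W n, w⁆ = β n • w)
    (hw : LieSubmodule.lieSpan ℂ W22 {w} = ⊤) (hπ : π w ≠ 0) : Function.Injective π := by
  obtain ⟨ρ, hρ⟩ := exists_algHom_toEnd_W V
  obtain ⟨ρ', hρ'⟩ := exists_algHom_toEnd_W V'
  let _ : Module (MvPolynomial ℕ ℂ) V := Module.compHom V ρ.toRingHom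
  let _ : Module (MvPolynomial ℕ ℂ) V' := Module.compHom V' ρ'.toRingHom
  have : IsScalarTower ℂ (MvPolynomial ℕ ℂ) V := ⟨fun c Q v => by
    change ρ (c • Q) v = c • ρ Q v
    rw [map_smul]; rfl⟩
  have : IsScalarTower ℂ (MvPolynomial ℕ ℂ) V' := ⟨fun c Q v => by
    change ρ' (c • Q) v = c • ρ' Q v
    rw [map_smul]; rfl⟩
  have D' : WhittakerData ξ α β w :=
    ⟨fun j v => congrArg (fun f => f v) (hρ' j), hz', hL, hW, hβ, hβ'⟩
  have D : WhittakerData ξ α β (π w) :=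
    ⟨fun j v => congrArg (fun f => f v) (hρ j), hz, fun n hn => by rw [← π.map_lie, hL n hn, map_smul],
      fun n hn => by rw [← π.map_lie, hW n hn, map_smul], hβ, hβ'⟩
  have hsmul (Q : MvPolynomial ℕ ℂ) (v : V') : π (Q • v) = Q • π v := by
    induction Q using MvPolynomial.induction_on generalizing v with
    | C a => rw [← algebraMap_eq, algebraMap_smul, algebraMap_smul, map_smul]
    | add p q hp hq => rw [add_smul, map_add, hp, hq, add_smul]
    | mul_X p j hp => rw [mul_smul, hp, D'.X_smul, π.map_lie, mul_smul, D.X_smul]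
  have hlist (l : List ℕ) : π (lieList w l) = lieList (π w) l := by
    induction l with
    | nil => rfl
    | cons j l ih => rw [lieList_cons, π.map_lie, ih, lieList_cons]
  have hsymb (f : MvPolynomial ℕ (MvPolynomial ℕ ℂ)) :
      π (symbolMap w f) = symbolMap (π w) f := by
    induction f using MvPolynomial.induction_on' with
    | monomial s c => rw [symbolMap_monomial, symbolMap_monomial, hsmul, hlist]
    | add p q hp hq => rw [map_add, map_add, map_add, hp, hq]
  rw [injective_iff_map_eq_zero]
  intro v hv
  obtain ⟨f, rfl⟩ := D'.symbolMap_surjective hw v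
  rw [hsymb] at hv
  rw [(map_eq_zero_iff _ (D.symbolMap_injective hπ)).1 hv, map_zero]

end Comparison

/-! ### The universal property of `L_{φ,ξ}` -/

/-- `ι` factors through the subalgebra S; its lift to S followed by the inclusion is the identity,
by uniqueness of lifts. -/
lemma adjoin_range_ι {g : Type*} [LieRing g] [LieAlgebra ℂ g] :
    Algebra.adjoin ℂ (Set.range (UniversalEnvelopingAlgebra.ι ℂ (L := g))) = ⊤ := by
  set S := Algebra.adjoin ℂ (Set.range (UniversalEnvelopingAlgebra.ι ℂ (L := g)))
  let f : g →ₗ⁅ℂ⁆ S :=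
    { toFun := fun x => ⟨UniversalEnvelopingAlgebra.ι ℂ x, Algebra.subset_adjoin ⟨x, rfl⟩⟩
      map_add' := fun x y => Subtype.ext (map_add _ x y)
      map_smul' := fun c x => Subtype.ext (map_smul _ c x)
      map_lie' := fun {x y} => Subtype.ext ((UniversalEnvelopingAlgebra.ι ℂ).map_lie x y) }
  have h : S.val.comp (UniversalEnvelopingAlgebra.lift ℂ f) = AlgHom.id ℂ _ := by
    refine UniversalEnvelopingAlgebra.hom_ext ℂ (LieHom.ext fun x => ?_)
    change S.val (UniversalEnvelopingAlgebra.lift ℂ f (UniversalEnvelopingAlgebra.ι ℂ x)) = _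
    rw [UniversalEnvelopingAlgebra.lift_ι_apply]
    rfl
  refine eq_top_iff.2 fun u _ => ?_
  have hu : S.val (UniversalEnvelopingAlgebra.lift ℂ f u) = u := DFunLike.congr_fun h u
  exact hu ▸ (UniversalEnvelopingAlgebra.lift ℂ f u).2

@[elab_as_elim]
lemma uea_induction {g : Type*} [LieRing g] [LieAlgebra ℂ g]
    {p : UniversalEnvelopingAlgebra ℂ g → Prop}
    (algebraMap : ∀ c, p (algebraMap ℂ _ c)) (ι : ∀ x, p (UniversalEnvelopingAlgebra.ι ℂ x))
    (add : ∀ a b, p a → p b → p (a + b)) (mul : ∀ a b, p a → p b → p (a * b))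
    (u : UniversalEnvelopingAlgebra ℂ g) : p u := by
  have hu : u ∈ Algebra.adjoin ℂ (Set.range (UniversalEnvelopingAlgebra.ι ℂ (L := g))) :=
    (adjoin_range_ι (g := g)) ▸ Algebra.mem_top
  induction hu using Algebra.adjoin_induction with
  | mem x hx => obtain ⟨x, rfl⟩ := hx; exact ι x
  | algebraMap c => exact algebraMap c
  | add a b _ _ ha hb => exact add a b ha hb
  | mul a b _ _ ha hb => exact mul a b ha hb

variable (φ : plus →ₗ⁅ℂ⁆ ℂ) (ξ : ℂ)

/-- `ℂ_φ` as a vector space. -/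
def CPhi.equiv : CPhi φ ≃ₗ[ℂ] ℂ := LinearEquiv.refl ℂ ℂ

lemma CPhi.equiv_smul (x : UPlus) (a : CPhi φ) :
    CPhi.equiv φ (x • a) = char φ x * CPhi.equiv φ a := rfl

/-- The generator of `ℂ_φ`. -/
def CPhi.gen : CPhi φ := (CPhi.equiv φ).symm 1

/-- The projection of `M_φ` onto `L_{φ,ξ}`. -/
def LMod.mk : M φ →ₗ[U] LMod φ ξ := (zSub φ ξ).mkQ

lemma LMod.mk_surjective : Function.Surjective (LMod.mk φ ξ) := (zSub φ ξ).mkQ_surjective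

/-- The generator of `L_{φ,ξ}`. -/
def LMod.gen : LMod φ ξ := LMod.mk φ ξ ((tensorRel φ).mkQ ((1 : U) ⊗ₜ[ℂ] CPhi.gen φ))

lemma zU_mul_comm (u : U) : zU * u = u * zU := by
  induction u using uea_induction with
  | algebraMap c => exact (Algebra.commutes c zU).symm
  | ι x =>
    have h := (UniversalEnvelopingAlgebra.ι ℂ).map_lie z x
    rw [lie_def, bracketHom_z_left, map_zero, LieRing.of_associative_ring_bracket] at h
    exact (sub_eq_zero.1 h.symm)
  | mul a b ha hb => rw [← mul_assoc, ha, mul_assoc, hb, mul_assoc]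
  | add a b ha hb => rw [mul_add, add_mul, ha, hb]

lemma CPhi.eq_smul_gen (a : CPhi φ) : a = CPhi.equiv φ a • CPhi.gen φ := by
  apply (CPhi.equiv φ).injective
  rw [map_smul, CPhi.gen, LinearEquiv.apply_symm_apply, smul_eq_mul, mul_one]

lemma LMod.exists_smul_gen (m : LMod φ ξ) : ∃ u : U, m = u • LMod.gen φ ξ := by
  obtain ⟨m, rfl⟩ := LMod.mk_surjective φ ξ m
  obtain ⟨t, rfl⟩ := (tensorRel φ).mkQ_surjective m
  induction t using TensorProduct.induction_on with
  | zero => exact ⟨0, by rw [map_zero, map_zero, zero_smul]⟩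
  | add x y hx hy =>
    obtain ⟨u, hu⟩ := hx
    obtain ⟨v, hv⟩ := hy
    exact ⟨u + v, by rw [map_add, map_add, hu, hv]; exact (add_smul u v _).symm⟩
  | tmul u a =>
    have key : u ⊗ₜ[ℂ] a = (CPhi.equiv φ a • u) • ((1 : U) ⊗ₜ[ℂ] CPhi.gen φ) := by
      rw [TensorProduct.smul_tmul', smul_eq_mul, mul_one, TensorProduct.smul_tmul,
        ← CPhi.eq_smul_gen]
    exact ⟨_, by rw [key, map_smul, map_smul]; rfl⟩

lemma LMod.incl_smul_gen (x : UPlus) :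
    incl x • LMod.gen φ ξ = char φ x • LMod.gen φ ξ := by
  have h : (incl x) ⊗ₜ[ℂ] CPhi.gen φ - (char φ x • (1 : U)) ⊗ₜ[ℂ] CPhi.gen φ ∈ tensorRel φ := by
    refine Submodule.subset_span ⟨1, x, CPhi.gen φ, ?_⟩
    rw [one_mul, TensorProduct.smul_tmul]
    congr 1
  have h' := congrArg (LMod.mk φ ξ) ((Submodule.Quotient.mk_eq_zero _).2 h)
  rw [← Submodule.mkQ_apply, map_sub, map_sub, map_zero, sub_eq_zero] at h'
  have e (u : U) : u • LMod.gen φ ξ = LMod.mk φ ξ ((tensorRel φ).mkQ (u ⊗ₜ[ℂ] CPhi.gen φ)) := by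
    rw [LMod.gen, ← map_smul, ← map_smul, TensorProduct.smul_tmul', smul_eq_mul, mul_one]
  rw [e, h', ← e, smul_assoc, one_smul]

lemma LMod.zU_smul (m : LMod φ ξ) : zU • m = ξ • m := by
  rw [← algebraMap_smul U ξ m, ← sub_eq_zero, ← sub_smul]
  obtain ⟨m, rfl⟩ := LMod.mk_surjective φ ξ m
  have h : (zU - algebraMap ℂ U ξ) • m ∈ zSub φ ξ := Submodule.subset_span ⟨m, rfl⟩
  exact (Submodule.Quotient.mk_eq_zero _).2 h

/-- Used twice: with target V, and with target the quotient of U by `annIdeal`. -/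
lemma LMod.exists_lift {N : Type*} [AddCommGroup N] [Module U N] [Module ℂ N] [IsScalarTower ℂ U N]
    (n : N) (hz : (zU - algebraMap ℂ U ξ) • n = 0)
    (hn : ∀ x : UPlus, incl x • n = char φ x • n) :
    ∃ f : LMod φ ξ →ₗ[U] N, f (LMod.gen φ ξ) = n := by
  let g₀ : U →ₗ[U] CPhi φ →ₗ[ℂ] N :=
    { toFun := fun u => (LinearMap.toSpanSingleton ℂ N (u • n)).comp (CPhi.equiv φ).toLinearMap
      map_add' := fun u v => LinearMap.ext fun a => by
        simp [add_smul, smul_add]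
      map_smul' := fun c u => LinearMap.ext fun a => by
        change CPhi.equiv φ a • ((c • u) • n) = c • (CPhi.equiv φ a • (u • n))
        rw [smul_eq_mul, mul_smul, ← algebraMap_smul U (CPhi.equiv φ a) (c • u • n),
          ← algebraMap_smul U (CPhi.equiv φ a) (u • n), ← mul_smul, ← mul_smul c,
          Algebra.commutes] }
  let g : U ⊗[ℂ] CPhi φ →ₗ[U] N := TensorProduct.AlgebraTensorModule.lift g₀
  have hg (u : U) (a : CPhi φ) : g (u ⊗ₜ a) = CPhi.equiv φ a • (u • n) := rfl
  have h1 : tensorRel φ ≤ LinearMap.ker g := by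
    refine Submodule.span_le.2 ?_
    rintro _ ⟨u, x, a, rfl⟩
    rw [SetLike.mem_coe, LinearMap.mem_ker, map_sub, hg, hg, sub_eq_zero, mul_smul, hn,
      CPhi.equiv_smul, ← algebraMap_smul U (char φ x) n, ← mul_smul u, ← Algebra.commutes,
      mul_smul _ u, algebraMap_smul, ← mul_smul, mul_comm]
  let g1 : M φ →ₗ[U] N := (tensorRel φ).liftQ g h1
  have h2 : zSub φ ξ ≤ LinearMap.ker g1 := by
    refine Submodule.span_le.2 ?_
    rintro _ ⟨m, rfl⟩
    obtain ⟨t, rfl⟩ := (tensorRel φ).mkQ_surjective m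
    rw [SetLike.mem_coe, LinearMap.mem_ker, map_smul]
    change (zU - algebraMap ℂ U ξ) • g t = 0
    induction t using TensorProduct.induction_on with
    | zero => rw [map_zero, smul_zero]
    | add x y hx hy => rw [map_add, smul_add, hx, hy, add_zero]
    | tmul u a =>
      rw [hg, ← smul_assoc (CPhi.equiv φ a) u n, ← mul_smul]
      generalize CPhi.equiv φ a • u = v
      -- Centrality lets z - ξ reach the vector n, which it kills.
      have : (zU - algebraMap ℂ U ξ) * v = v * (zU - algebraMap ℂ U ξ) := by
        rw [sub_mul, mul_sub, zU_mul_comm, Algebra.commutes]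
      rw [this, mul_smul, hz, smul_zero]
  refine ⟨(zSub φ ξ).liftQ g1 h2, ?_⟩
  change CPhi.equiv φ (CPhi.gen φ) • ((1 : U) • n) = n
  rw [CPhi.gen, LinearEquiv.apply_symm_apply, one_smul, one_smul]

/-! ### Values of φ, and recovering Whittaker vectors from the products L_λ W_μ. -/

lemma lie_plusL_plusL (k m : ℕ+) : ⁅plusL k, plusL m⁆ = ((m : ℂ) - k) • plusL (m + k) := by
  refine Subtype.ext ?_
  change bracketHom (L k) (L m) = ((m : ℂ) - k) • L ((m + k : ℕ+) : ℤ)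
  rw [bracketHom_LL, cocycle, if_neg (by have := k.pos; omega), zero_smul, add_zero]
  push_cast
  rfl

lemma lie_plusL_plusW (k m : ℕ+) : ⁅plusL k, plusW m⁆ = ((m : ℂ) - k) • plusW (m + k) := by
  refine Subtype.ext ?_
  change bracketHom (L k) (W m) = ((m : ℂ) - k) • W ((m + k : ℕ+) : ℤ)
  rw [bracketHom_LW, cocycle, if_neg (by have := k.pos; omega), zero_smul, add_zero]
  push_cast
  rfl

lemma map_lie_eq_zero (φ : plus →ₗ⁅ℂ⁆ ℂ) (x y : plus) : φ ⁅x, y⁆ = 0 := by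
  rw [φ.map_lie, LieRing.of_associative_ring_bracket, mul_comm, sub_self]

lemma sub_mul_map_plusW (φ : plus →ₗ⁅ℂ⁆ ℂ) (k m : ℕ+) :
    ((m : ℂ) - k) * φ (plusW (m + k)) = 0 := by
  rw [← smul_eq_mul, ← map_smul, ← lie_plusL_plusW, map_lie_eq_zero]

lemma map_plusW_eq_zero (φ : plus →ₗ⁅ℂ⁆ ℂ) (n : ℕ+) (hn : 3 ≤ n) : φ (plusW n) = 0 := by
  obtain ⟨m, rfl⟩ : ∃ m : ℕ+, n = m + 1 :=
    ⟨n - 1, (PNat.sub_add_of_lt (lt_of_lt_of_le (by decide) hn)).symm⟩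
  have hm : m ≠ 1 := by rintro rfl; exact absurd hn (by decide)
  refine (mul_eq_zero.1 (sub_mul_map_plusW φ 1 m)).resolve_left (sub_ne_zero.2 ?_)
  exact_mod_cast hm

lemma incl_ι (x : plus) :
    incl (UniversalEnvelopingAlgebra.ι ℂ x) = UniversalEnvelopingAlgebra.ι ℂ (x : W22) := by
  rw [incl, UniversalEnvelopingAlgebra.lift_ι_apply]
  rfl

lemma char_ι (φ : plus →ₗ⁅ℂ⁆ ℂ) (x : plus) :
    char φ (UniversalEnvelopingAlgebra.ι ℂ x) = φ x := by
  rw [char, UniversalEnvelopingAlgebra.lift_ι_apply]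

section UModule

variable {N : Type*} [AddCommGroup N] [Module U N] [Module ℂ N] [IsScalarTower ℂ U N]

lemma smul_smul_comm_of_tower (c : ℂ) (u : U) (n : N) : u • c • n = c • u • n := by
  rw [← algebraMap_smul U c n, ← algebraMap_smul U c (u • n), ← mul_smul, ← mul_smul,
    Algebra.commutes]

lemma incl_smul_eq (φ : plus →ₗ⁅ℂ⁆ ℂ) (n : N)
    (h : ∀ x : plus, incl (UniversalEnvelopingAlgebra.ι ℂ x) • n = φ x • n) (x : UPlus) :
    incl x • n = char φ x • n := by
  induction x using uea_induction with
  | algebraMap c => rw [AlgHom.commutes, AlgHom.commutes, algebraMap_smul]; rfl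
  | ι x => rw [h, char_ι]
  | add a b ha hb => rw [map_add, map_add, add_smul, add_smul, ha, hb]
  | mul a b ha hb =>
    rw [map_mul, map_mul, mul_smul, hb, smul_smul_comm_of_tower, ha, ← mul_smul, mul_comm]

lemma incl_ι_smul_eq (φ : plus →ₗ⁅ℂ⁆ ℂ) (n : N)
    (hL : ∀ k, incl (UniversalEnvelopingAlgebra.ι ℂ (plusL k)) • n = φ (plusL k) • n)
    (hW : ∀ k, incl (UniversalEnvelopingAlgebra.ι ℂ (plusW k)) • n = φ (plusW k) • n)
    (x : plus) : incl (UniversalEnvelopingAlgebra.ι ℂ x) • n = φ x • n := by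
  obtain ⟨x, hx⟩ := x
  change x ∈ Submodule.span ℂ {x | ∃ n : ℤ, 0 < n ∧ (x = L n ∨ x = W n)} at hx
  induction hx using Submodule.span_induction with
  | mem x hx =>
    obtain ⟨k, hk, rfl | rfl⟩ := hx
    · lift k to ℕ using hk.le
      exact hL ⟨k, by omega⟩
    · lift k to ℕ using hk.le
      exact hW ⟨k, by omega⟩
  | zero =>
    change incl (UniversalEnvelopingAlgebra.ι ℂ (0 : plus)) • n = φ 0 • n
    simp
  | add x y hx hy h1 h2 =>
    change incl (UniversalEnvelopingAlgebra.ι ℂ (⟨x, hx⟩ + ⟨y, hy⟩ : plus)) • n =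
      φ (⟨x, hx⟩ + ⟨y, hy⟩) • n
    rw [map_add, map_add, map_add, add_smul, add_smul, h1, h2]
  | smul c x hx h1 =>
    change incl (UniversalEnvelopingAlgebra.ι ℂ (c • ⟨x, hx⟩ : plus)) • n = φ (c • ⟨x, hx⟩) • n
    rw [map_smul, map_smul, map_smul, smul_assoc, h1, smul_assoc]

/-- For non-singular `φ`, a vector on which all products `L_λ W_μ` act by `φ` is a Whittaker
vector. -/
lemma incl_smul_eq_of_partitions (φ : plus →ₗ⁅ℂ⁆ ℂ) (hφ : NonSingular φ) (n : N)
    (h : ∀ lam mu : PosPartition, incl (lam.L * mu.W) • n = char φ (lam.L * mu.W) • n)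
    (x : UPlus) : incl x • n = char φ x • n := by
  set l : ℕ+ → U := fun k => incl (UniversalEnvelopingAlgebra.ι ℂ (plusL k)) with hl
  set y : ℕ+ → U := fun k => incl (UniversalEnvelopingAlgebra.ι ℂ (plusW k)) with hy
  have ha : φ (plusL 1) ≠ 0 := left_ne_zero_of_mul hφ.1
  have hb : φ (plusW 1) ≠ 0 := right_ne_zero_of_mul hφ.1
  have comm (k m : ℕ+) : l k * y m = y m * l k + ((m : ℂ) - k) • y (m + k) := by
    have h := congrArg incl ((UniversalEnvelopingAlgebra.ι ℂ).map_lie (plusL k) (plusW m))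
    rw [lie_plusL_plusW, LieRing.of_associative_ring_bracket, map_sub, map_mul, map_mul, map_smul,
      map_smul] at h
    rw [h]
    exact (add_sub_cancel _ _).symm
  have h11 (k m : ℕ+) : l k • y m • n = (φ (plusL k) * φ (plusW m)) • n := by
    have := h ⟨[k], by simp, by simp⟩ ⟨[m], by simp, by simp⟩
    simpa only [PosPartition.L, PosPartition.W, List.map_cons, List.map_nil, List.prod_cons,
      List.prod_nil, mul_one, map_mul, char_ι, mul_smul] using this
  have h12 : l 1 • y 1 • y 1 • n = (φ (plusL 1) * (φ (plusW 1) * φ (plusW 1))) • n := by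
    have := h ⟨[1], by simp, by simp⟩ ⟨[1, 1], by simp, by simp⟩
    simpa only [PosPartition.L, PosPartition.W, List.map_cons, List.map_nil, List.prod_cons,
      List.prod_nil, mul_one, map_mul, char_ι, mul_smul] using this
  -- Both partitions are non-empty, so W_1 alone is not among the relations. As L_1 and W_1 commute,
  -- comparing L_1 W_1 W_1 with L_1 W_1 isolates it after division by φ(L_1) φ(W_1).
  have hW1 : y 1 • n = φ (plusW 1) • n := by
    rw [← mul_smul, comm, sub_self, zero_smul, add_zero, mul_smul, h11, smul_smul_comm_of_tower,
      ← mul_assoc, mul_smul] at h12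
    rw [mul_smul] at h12
    exact smul_right_injective N (mul_ne_zero ha hb) (by simpa [mul_smul] using h12)
  have hL (k : ℕ+) : l k • n = φ (plusL k) • n := by
    have := h11 k 1
    rw [hW1, smul_smul_comm_of_tower, mul_comm, mul_smul] at this
    exact smul_right_injective N hb this
  -- With x_m = W_m n - φ(W_m) n, the commutator of L_k and W_m gives φ(L_k) x_m + (m - k) x_{m+k} =
  -- 0. Taking k = 1 passes from x_{m+1} = 0 down to x_m = 0.
  have rel (k m : ℕ+) : φ (plusL k) • (y m • n - φ (plusW m) • n) +
      ((m : ℂ) - k) • (y (m + k) • n - φ (plusW (m + k)) • n) = 0 := by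
    have h1 := h11 k m
    rw [← mul_smul, comm, add_smul, mul_smul, hL, smul_smul_comm_of_tower, smul_assoc] at h1
    have h2 := congrArg (fun c : ℂ => c • n) (sub_mul_map_plusW φ k m)
    simp only [mul_smul, zero_smul] at h2
    rw [smul_sub, smul_sub, h2, sub_zero, sub_add_eq_add_sub, h1, ← mul_smul, sub_self]
  have down (m : ℕ+) (hm : y (m + 1) • n - φ (plusW (m + 1)) • n = 0) :
      y m • n - φ (plusW m) • n = 0 := by
    have h1 := rel 1 m
    rw [hm, smul_zero, add_zero] at h1
    exact (smul_eq_zero.1 h1).resolve_left ha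
  have φL (k : ℕ+) (hk : 3 ≤ k) : φ (plusL k) = 0 := by
    obtain ⟨m, rfl⟩ : ∃ m : ℕ+, k = m + 1 :=
      ⟨k - 1, (PNat.sub_add_of_lt (lt_of_lt_of_le (by decide) hk)).symm⟩
    have hm : m ≠ 1 := by rintro rfl; exact absurd hk (by decide)
    have h1 : ((m : ℂ) - (1 : ℕ+)) * φ (plusL (m + 1)) = 0 := by
      rw [← smul_eq_mul, ← map_smul, ← lie_plusL_plusL, map_lie_eq_zero]
    refine (mul_eq_zero.1 h1).resolve_left (sub_ne_zero.2 ?_)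
    exact_mod_cast hm
  -- Since φ(L_3) = 0, taking k = 3 gives vanishing far out, except at m = 3 where the coefficient m
  -- - k is zero; that index is reached by descent.
  have big (m : ℕ+) (hm : m ≠ 3) : y (m + 3) • n - φ (plusW (m + 3)) • n = 0 := by
    have h1 := rel 3 m
    rw [φL 3 le_rfl, zero_smul, zero_add] at h1
    refine (smul_eq_zero.1 h1).resolve_left (sub_ne_zero.2 ?_)
    exact_mod_cast hm
  have hX (m : ℕ+) : y m • n - φ (plusW m) • n = 0 := by
    by_cases h3 : m = 3
    · subst h3
      exact down _ (big 1 (by decide))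
    · exact down _ (down _ (down _ (by rw [add_assoc, add_assoc]; exact big m h3)))
  exact incl_smul_eq φ n (incl_ι_smul_eq φ n hL fun k => sub_eq_zero.1 (hX k)) x

end UModule

lemma LMod.smul_mem {φ : plus →ₗ⁅ℂ⁆ ℂ} {ξ : ℂ} (N : LieSubmodule ℂ W22 (LMod φ ξ)) (u : U) :
    ∀ m ∈ N, u • m ∈ N := by
  induction u using uea_induction with
  | algebraMap c => intro m hm; rw [algebraMap_smul]; exact N.smul_mem c hm
  | ι x => intro m hm; exact N.lie_mem (x := x) hm
  | add a b ha hb => intro m hm; rw [add_smul]; exact add_mem (ha m hm) (hb m hm)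
  | mul a b ha hb => intro m hm; rw [mul_smul]; exact ha _ (hb m hm)

lemma LMod.lieSpan_gen (φ : plus →ₗ⁅ℂ⁆ ℂ) (ξ : ℂ) :
    LieSubmodule.lieSpan ℂ W22 {LMod.gen φ ξ} = ⊤ := by
  refine eq_top_iff.2 fun m _ => ?_
  obtain ⟨u, rfl⟩ := LMod.exists_smul_gen φ ξ m
  exact LMod.smul_mem _ u _ (LieSubmodule.subset_lieSpan rfl)

/-! ### The embedding of L_{φ,ξ} and the annihilator of its generator. -/

section Main

variable {V : Type*} [AddCommGroup V] [Module ℂ V] [LieRingModule W22 V] [LieModule ℂ W22 V]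

/-- The map `L_{φ,ξ} → V` determined by a nonzero Whittaker vector is injective. -/
lemma exists_injective_of_isWhittakerVector {φ : plus →ₗ⁅ℂ⁆ ℂ} (hφ : φ (plusW 2) ≠ 0) {ξ : ℂ}
    (hz : ∀ v : V, ⁅z, v⁆ = ξ • v) {w : V} (hw : IsWhittakerVector φ w) (hw0 : w ≠ 0) :
    annIdeal φ ξ ≤ ann w ∧ ∃ π : LMod φ ξ →ₗ⁅ℂ, W22⁆ V, Function.Injective π ∧
      π (LMod.gen φ ξ) = w ∧
      ∀ u : U, π (u • LMod.gen φ ξ) =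
        UniversalEnvelopingAlgebra.lift ℂ (LieModule.toEnd ℂ W22 V) u w := by
  set ρ := UniversalEnvelopingAlgebra.lift ℂ (LieModule.toEnd ℂ W22 V) with hρ
  let _ : Module U V := Module.compHom V ρ.toRingHom
  have : IsScalarTower ℂ U V := ⟨fun c u v => by
    change ρ (c • u) v = c • ρ u v
    rw [map_smul]; rfl⟩
  have hι (x : W22) (v : V) : UniversalEnvelopingAlgebra.ι ℂ x • v = ⁅x, v⁆ := by
    change ρ (UniversalEnvelopingAlgebra.ι ℂ x) v = _
    rw [hρ, UniversalEnvelopingAlgebra.lift_ι_apply]; rfl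
  have hn := incl_smul_eq φ w (fun x => by rw [incl_ι, hι]; exact hw x)
  have hz' : (zU - algebraMap ℂ U ξ) • w = 0 := by
    rw [sub_smul, algebraMap_smul, zU, hι, hz, sub_self]
  obtain ⟨f, hf⟩ := LMod.exists_lift φ ξ w hz' hn
  let π : LMod φ ξ →ₗ⁅ℂ, W22⁆ V :=
    { toFun := f
      map_add' := map_add f
      map_smul' := fun c m => by
        rw [← algebraMap_smul U c m, map_smul, algebraMap_smul]; rfl
      map_lie' := fun {x m} => by
        change f (UniversalEnvelopingAlgebra.ι ℂ x • m) = ⁅x, f m⁆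
        rw [map_smul, hι] }
  have hπ : π (LMod.gen φ ξ) = w := hf
  refine ⟨?_, π, ?_, hπ, fun u => (map_smul f u _).trans (by rw [hf]; rfl)⟩
  · refine sup_le ?_ (iSup₂_le fun lam mu => ?_)
    · rw [Ideal.span_le, Set.singleton_subset_iff]
      exact hz'
    · rw [Ideal.span_le, Set.singleton_subset_iff]
      change (_ - algebraMap ℂ U _) • w = 0
      rw [sub_smul, hn, algebraMap_smul, sub_self]
  · refine injective_of_isWhittakerVector (ξ := ξ)
      (α := fun n => if h : 0 < n then φ (plusL ⟨n.toNat, by omega⟩) else 0)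
      (β := fun n => if h : 0 < n then φ (plusW ⟨n.toNat, by omega⟩) else 0)
      ?_ ?_ π (LMod.gen φ ξ) (fun v => LMod.zU_smul φ ξ v) hz ?_ ?_ (LMod.lieSpan_gen φ ξ)
      (hπ ▸ hw0)
    · rw [dif_pos two_pos]
      exact hφ
    · intro n hn
      rw [dif_pos (by omega)]
      exact map_plusW_eq_zero φ _ (by change 3 ≤ n.toNat; omega)
    · intro n hn
      lift n to ℕ using hn.le
      rw [dif_pos hn]
      have := LMod.incl_smul_gen φ ξ (UniversalEnvelopingAlgebra.ι ℂ (plusL ⟨n, by omega⟩))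
      rw [incl_ι, char_ι] at this
      exact this
    · intro n hn
      lift n to ℕ using hn.le
      rw [dif_pos hn]
      have := LMod.incl_smul_gen φ ξ (UniversalEnvelopingAlgebra.ι ℂ (plusW ⟨n, by omega⟩))
      rw [incl_ι, char_ι] at this
      exact this

/-- The map from L_{φ,ξ} to the quotient by `annIdeal` that sends the generator to the class of 1
sends u • gen to the class of u. -/
lemma mem_annIdeal_of_smul_gen_eq_zero {φ : plus →ₗ⁅ℂ⁆ ℂ} (hφ : NonSingular φ) {ξ : ℂ} {u : U}
    (hu : u • LMod.gen φ ξ = 0) : u ∈ annIdeal φ ξ := by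
  have mk (v : U) : v • (annIdeal φ ξ).mkQ 1 = (annIdeal φ ξ).mkQ v := by
    rw [← map_smul, smul_eq_mul, mul_one]
  have hz : (zU - algebraMap ℂ U ξ) • (annIdeal φ ξ).mkQ 1 = 0 := by
    rw [mk]
    exact (Submodule.Quotient.mk_eq_zero _).2
      (Ideal.mem_sup_left (Ideal.subset_span rfl))
  obtain ⟨f, hf⟩ := LMod.exists_lift φ ξ ((annIdeal φ ξ).mkQ 1) hz
    (incl_smul_eq_of_partitions φ hφ _ fun lam mu => by
      rw [← algebraMap_smul U, ← sub_eq_zero, ← sub_smul, mk]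
      refine (Submodule.Quotient.mk_eq_zero _).2 (Ideal.mem_sup_right ?_)
      exact Submodule.mem_iSup_of_mem lam (Submodule.mem_iSup_of_mem mu (Ideal.subset_span rfl)))
  have h := congrArg f hu
  rw [map_smul, hf, mk, map_zero] at h
  exact (Submodule.Quotient.mk_eq_zero _).1 h

lemma IsCyclicWhittakerVector.ne_zero [Nontrivial V] {φ : plus →ₗ⁅ℂ⁆ ℂ} {w : V}
    (hw : IsCyclicWhittakerVector φ w) : w ≠ 0 := by
  rintro rfl
  have h := hw.2
  have h0 : LieSubmodule.lieSpan ℂ W22 {(0 : V)} ≤ ⊥ :=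
    LieSubmodule.lieSpan_le.2 (by simp)
  rw [h, top_le_iff] at h0
  exact bot_ne_top h0

end Main

end W22

end

theorem proposition4p3p2 (φ : W22.plus →ₗ⁅ℂ⁆ ℂ) (ξ : ℂ)
    (V : Type*) [AddCommGroup V] [Module ℂ V] [LieRingModule W22 V] [LieModule ℂ W22 V]
    [Nontrivial V] (hV : W22.IsWhittakerModule V φ)
    (hz : ∀ v : V, ⁅W22.z, v⁆ = ξ • v) :
    Nonempty (V ≃ₗ⁅ℂ,W22⁆ W22.LMod φ ξ) ∧
      ∀ w : V, W22.IsCyclicWhittakerVector φ w → W22.ann w = W22.annIdeal φ ξ := by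
  obtain ⟨hφ, w, hw⟩ := hV
  have hβ : φ (W22.plusW 2) ≠ 0 := right_ne_zero_of_mul hφ.2
  refine ⟨?_, fun w hw => ?_⟩
  · obtain ⟨-, π, hπ, hgen, -⟩ := W22.exists_injective_of_isWhittakerVector hβ hz hw.1 hw.ne_zero
    have hrange : π.range = ⊤ := by
      rw [eq_top_iff, ← hw.2, LieSubmodule.lieSpan_le, Set.singleton_subset_iff]
      exact ⟨_, hgen⟩
    have hsurj : Function.Surjective π := fun v => by
      have : v ∈ π.range := hrange ▸ LieSubmodule.mem_top v
      exact (LieModuleHom.mem_range π v).1 this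
    let e := LinearEquiv.ofBijective (π : W22.LMod φ ξ →ₗ[ℂ] V) ⟨hπ, hsurj⟩
    let e' : W22.LMod φ ξ ≃ₗ⁅ℂ,W22⁆ V :=
      { π with
        invFun := e.symm
        left_inv := e.left_inv
        right_inv := e.right_inv }
    exact ⟨e'.symm⟩
  · obtain ⟨hle, π, hπ, -, hsmul⟩ :=
      W22.exists_injective_of_isWhittakerVector hβ hz hw.1 hw.ne_zero
    refine le_antisymm (fun u hu => W22.mem_annIdeal_of_smul_gen_eq_zero hφ (hπ ?_)) hle
    rw [hsmul, map_zero]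
    exact hu
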